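/- Let $r\ge 2$ be an integer and put $$x^{*}=\frac{(r+1)^{(r+1)/2}}{2(r-1)^{(r-1)/2}},\qquad \sigma(\varphi)=\frac{(\sin(r+1)\varphi)^{(r+1)/2}}{\sin 2\varphi\,(\sin(r-1)\varphi)^{(r-1)/2}},\quad 0<\varphi<\frac{\pi}{r+1}.$$ Then $\sigma$ is a strictly decreasing bijection from $(0,\pi/(r+1))$ onto $(0,x^{*})$. For $\alpha\ge 1$ and $0<\beta\le\alpha$, the Raney distribution $R_{\alpha,\beta}$ is the probability measure with compact support in $[0,\infty)$ whose $n$-th moment is $\frac{\beta}{\alpha n+\beta}\binom{\alpha n+\beta}{n}$ for all $n=0,1,2,\dots$, where $\binom{y}{n}=y(y-1)\cdots(y-n+1)/n!$. The distribution $R_{\frac{r+1}{2},\frac12}$ exists and is unique. It is carried by $(0,x^{*})$ and has a continuous density $v$ there with respect to Lebesgue measure. If $x=\sigma(\varphi)$ with $0<\varphi<\pi/(r+1)$, then $$v(x)=\frac{\sin 2\varphi\,\sin\varphi\,(\sin(r-1)\varphi)^{\frac r2-1}}{\pi\,(\sin(r+1)\varphi)^{\frac r2}},$$ and the distribution function $V(x)=R_{\frac{r+1}{2},\frac12}((-\infty,x])$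 is given by $$V(x)=\frac12+\frac{(r-1)\sin\varphi}{\pi}\left(\frac{\sin(r+1)\varphi}{\sin(r-1)\varphi}\right)^{1/2}+\frac1\pi\arctan\left(\frac{\cos r\varphi}{\sqrt{\sin(r-1)\varphi\,\sin(r+1)\varphi}}\right).$$ -/

import Mathlib

open MeasureTheory

noncomputable section

/-- The Raney numbers `R_{α,β}(n) = β / (α n + β) * binom (α n + β) n`, where
`Ring.choose y n = y (y - 1) ⋯ (y - n + 1) / n!` is the generalized binomial coefficient. -/
def raneyNumber (α β : ℝ) (n : ℕ) : ℝ :=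
  β / (α * n + β) * Ring.choose (α * n + β) n

/-- `μ` is the Raney distribution `R_{α,β}`: a probability measure with compact support in
`[0, ∞)` whose moments are the Raney numbers. -/
structure IsRaneyDistribution (α β : ℝ) (μ : Measure ℝ) : Prop where
  isProbabilityMeasure : IsProbabilityMeasure μ
  exists_support_subset : ∃ b : ℝ, μ (Set.Icc 0 b)ᶜ = 0
  moment_eq : ∀ n : ℕ, ∫ x, x ^ n ∂μ = raneyNumber α β n

/-- `v` is a continuous (Lebesgue) density on `s` of the measure `μ`, which is carried by `s`. -/
structure IsContinuousDensityOn (v : ℝ → ℝ) (s : Set ℝ) (μ : Measure ℝ) : Prop where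
  continuousOn : ContinuousOn v s
  nonneg : ∀ x ∈ s, 0 ≤ v x
  eq_withDensity : μ = (volume.restrict s).withDensity (fun x => ENNReal.ofReal (v x))

/-- The right endpoint `(r+1)^((r+1)/2) / (2 (r-1)^((r-1)/2))` of the support. -/
def raneyEndpoint (r : ℕ) : ℝ :=
  ((r : ℝ) + 1) ^ (((r : ℝ) + 1) / 2) / (2 * ((r : ℝ) - 1) ^ (((r : ℝ) - 1) / 2))

/-- The parametrization `σ(φ)` of the support. -/
def raneySigma (r : ℕ) (φ : ℝ) : ℝ :=
  Real.sin (((r : ℝ) + 1) * φ) ^ (((r : ℝ) + 1) / 2) /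
    (Real.sin (2 * φ) * Real.sin (((r : ℝ) - 1) * φ) ^ (((r : ℝ) - 1) / 2))

end

/-!
With `S± = sin ((r ± 1) φ)`, consider the curve `u(φ) = √(S₊ / S₋) e^{iφ}` in the first quadrant,
running from the real point `√((r + 1) / (r - 1)) > 1` to `0` (`raneyCurve`). It satisfies
`σ(φ) (u² - 1) = u ^ (r + 1)` (`raneySigma_mul_sq_sub_one`), so `σ` is the restriction to the curve
of the rational function `u ^ (r + 1) / (u² - 1)`. That `σ` decreases is seen on its logarithmic
derivative, which is minus a sum of squares over a positive quantity (`hasDerivAt_raneySigma`).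

The candidate density is `x ↦ Im u / (π x)`, where `x = σ(φ)`. Substituting `x = σ(φ)` and
integrating by parts, its moment of order `n ≥ 1` becomes `(1 / (n π)) Im ∫ σ ^ n du`, the integral
being over the curve, and `σ ^ n = u ^ ((r + 1) n) / (u² - 1) ^ n` has an explicit primitive. Since
the endpoints of the curve are real and the integrand is real on the real axis, only the
logarithmic term of this primitive contributes to the imaginary part. The reduction
`∫ u ^ (k + 2) / (u² - 1) ^ (m + 2) = (k + 1) / (2 (m + 1)) ∫ u ^ k / (u² - 1) ^ (m + 1)`, valid up
to real boundary terms, leads to `m = 0` and gives the value as a generalized binomial coefficient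
(`hasPrimitiveIncrement_pow_div_pow`), which is the Raney number (`integral_raneyWeight_mul_pow`).

For `n = 0` and for the distribution function, `u dx / x` along the curve is the differential of
`(r - 1) u + log ((u + 1) / (u - 1))` (`hasDerivAt_raneyCdfPrimitive`); its imaginary part is the
arctangent expression (`raneyCdfPrimitive_eq`).

Uniqueness is Weierstrass approximation on a compact interval
(`MeasureTheory.Measure.eq_of_integral_pow_eq`), and two continuous densities of one measure on an
open set agree everywhere on it (`IsContinuousDensityOn.eqOn`).
-/

open Filter Topology Complex Set

/-! ### Generalized binomial coefficients, improper integrals, determinacy of moments -/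

lemma Ring.choose_add_one_succ (y : ℝ) (n : ℕ) :
    Ring.choose (y + 1) (n + 1) = (y + 1) / (n + 1) * Ring.choose y n := by
  have h := Ring.choose_add_smul_choose y n 1
  have hn : (n : ℝ) + 1 ≠ 0 := by positivity
  simp only [Nat.choose_one_right, Nat.cast_one, Ring.choose_one_right, nsmul_eq_mul,
    Nat.cast_add] at h
  field_simp
  linarith

/-- Fundamental theorem of calculus on an open interval for a nonnegative derivative, given only
one-sided limits of the primitive; integrability comes for free from the sign. -/
lemma integrableOn_and_integral_eq_of_hasDerivAt_of_tendsto {a b : ℝ} (hab : a < b)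
    {f f' : ℝ → ℝ} {fa fb : ℝ} (hderiv : ∀ x ∈ Ioo a b, HasDerivAt f (f' x) x)
    (hpos : ∀ x ∈ Ioo a b, 0 ≤ f' x)
    (ha : Tendsto f (𝓝[>] a) (𝓝 fa)) (hb : Tendsto f (𝓝[<] b) (𝓝 fb)) :
    IntegrableOn f' (Ioo a b) ∧ ∫ x in Ioo a b, f' x = fb - fa := by
  have hF : ContinuousOn (extendFrom (Ioo a b) f) (Icc a b) :=
    continuousOn_Icc_extendFrom_Ioo
      (fun x hx => (hderiv x hx).continuousAt.continuousWithinAt) ha hb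
  have hF' : ∀ x ∈ Ioo a b, HasDerivAt (extendFrom (Ioo a b) f) (f' x) x := by
    intro x hx
    refine (hderiv x hx).congr_of_eventuallyEq ?_
    filter_upwards [isOpen_Ioo.mem_nhds hx] with y hy
    exact extendFrom_extends (fun z hz => (hderiv z hz).continuousAt.continuousWithinAt) y hy
  have hint := intervalIntegral.integrableOn_deriv_of_nonneg hF hF' hpos
  refine ⟨hint.mono_set Ioo_subset_Ioc_self, ?_⟩
  rw [← integral_Ioc_eq_integral_Ioo, ← intervalIntegral.integral_of_le hab.le]
  exact intervalIntegral.integral_eq_sub_of_hasDerivAt_of_tendsto hab hderiv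
    ((intervalIntegrable_iff_integrableOn_Ioc_of_le hab.le).2 hint) ha hb

/-- A probability measure carried by a compact interval is determined by its moments: polynomials
are uniformly dense in the continuous functions on the interval. -/
lemma MeasureTheory.Measure.eq_of_integral_pow_eq {μ ν : Measure ℝ} [IsProbabilityMeasure μ]
    [IsProbabilityMeasure ν] {b : ℝ} (hμ : μ (Icc 0 b)ᶜ = 0) (hν : ν (Icc 0 b)ᶜ = 0)
    (h : ∀ n : ℕ, ∫ x, x ^ n ∂μ = ∫ x, x ^ n ∂ν) : μ = ν := by
  have key : ∀ (ρ : Measure ℝ) [IsProbabilityMeasure ρ], ρ (Icc 0 b)ᶜ = 0 →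
      ∀ f : ℝ → ℝ, Continuous f → Integrable f ρ := by
    intro ρ _ hρ f hf
    have hr : ρ.restrict (Icc 0 b) = ρ :=
      Measure.restrict_eq_self_of_ae_mem (by rwa [ae_iff])
    rw [← hr]
    exact hf.continuousOn.integrableOn_compact isCompact_Icc
  have hpoly : ∀ p : Polynomial ℝ, ∫ x, p.eval x ∂μ = ∫ x, p.eval x ∂ν := by
    intro p
    simp only [Polynomial.eval_eq_sum_range]
    rw [integral_finsetSum _ (fun i _ => key μ hμ _ (by fun_prop)),
      integral_finsetSum _ (fun i _ => key ν hν _ (by fun_prop))]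
    simp only [integral_const_mul, h]
  have hnear : ∀ (ρ : Measure ℝ) [IsProbabilityMeasure ρ], ρ (Icc 0 b)ᶜ = 0 →
      ∀ f : ℝ → ℝ, Continuous f → ∀ p : Polynomial ℝ, ∀ ε > 0,
      (∀ x ∈ Icc 0 b, |p.eval x - f x| < ε) → |∫ x, p.eval x ∂ρ - ∫ x, f x ∂ρ| ≤ ε := by
    intro ρ _ hρ f hf p ε hε hp
    rw [← integral_sub (key ρ hρ _ p.continuous) (key ρ hρ f hf)]
    have := norm_integral_le_of_norm_le_const (μ := ρ) (f := fun x => p.eval x - f x) (C := ε) (by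
      have : ∀ᵐ x ∂ρ, x ∈ Icc 0 b := by rwa [ae_iff]
      filter_upwards [this] with x hx using (hp x hx).le)
    simpa using this
  refine ext_of_forall_integral_eq_of_IsFiniteMeasure fun f => ?_
  refine eq_of_abs_sub_le_all fun ε hε => ?_
  obtain ⟨p, hp⟩ := exists_polynomial_near_of_continuousOn 0 b f f.continuous.continuousOn
    (ε / 2) (by positivity)
  have h1 := hnear μ hμ f f.continuous p _ (by positivity) hp
  have h2 := hnear ν hν f f.continuous p _ (by positivity) hp
  rw [abs_le] at *
  rw [hpoly p] at h1
  constructor <;> linarith [h1.1, h1.2, h2.1, h2.2]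

/-! ### Primitives of `u ^ k / (u² - 1) ^ m` on the first quadrant -/

/-- The closed first quadrant of `ℂ` without the pole `1`. The points `0` and `a > 1` belong to it,
so that primitives are differentiable at the endpoints of the curve as well. -/
def closedQuadrant : Set ℂ := {u | 0 ≤ u.im ∧ 0 ≤ u.re ∧ u ≠ 1}

lemma zero_mem_closedQuadrant : (0 : ℂ) ∈ closedQuadrant := by simp [closedQuadrant]

lemma ofReal_mem_closedQuadrant {a : ℝ} (ha : 1 < a) : (a : ℂ) ∈ closedQuadrant := by
  refine ⟨by simp, by simp; linarith, ?_⟩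
  exact_mod_cast ha.ne'

lemma sub_one_ne_zero_of_mem_closedQuadrant {u : ℂ} (hu : u ∈ closedQuadrant) : u - 1 ≠ 0 :=
  sub_ne_zero.2 hu.2.2

lemma add_one_ne_zero_of_mem_closedQuadrant {u : ℂ} (hu : u ∈ closedQuadrant) : u + 1 ≠ 0 := by
  intro h
  have := congrArg Complex.re h
  simp at this
  linarith [hu.2.1]

lemma sq_sub_one_ne_zero_of_mem_closedQuadrant {u : ℂ} (hu : u ∈ closedQuadrant) :
    u ^ 2 - 1 ≠ 0 := by
  have : u ^ 2 - 1 = (u - 1) * (u + 1) := by ring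
  rw [this]
  exact mul_ne_zero (sub_one_ne_zero_of_mem_closedQuadrant hu)
    (add_one_ne_zero_of_mem_closedQuadrant hu)

/-- The factor `-I` turns the closed upper half plane into the closed right half plane, so that the
branch cut of `log` is avoided even for `u` on the real axis, on both sides of `1`. -/
lemma hasDerivAt_log_sub_one {u : ℂ} (hu : u ∈ closedQuadrant) :
    HasDerivAt (fun u => log (-I * (u - 1))) (1 / (u - 1)) u := by
  have h1 : HasDerivAt (fun u : ℂ => -I * (u - 1)) (-I) u := by
    simpa using ((hasDerivAt_id u).sub_const 1).const_mul (-I)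
  have hs : -I * (u - 1) ∈ slitPlane := by
    rw [mem_slitPlane_iff]
    simp only [mul_re, mul_im, neg_re, neg_im, I_re, I_im, sub_re, sub_im, one_re, one_im]
    rcases hu.1.lt_or_eq with h | h
    · left; linarith
    · right
      intro h'
      exact hu.2.2 (Complex.ext (by simp; linarith) (by simp [← h]))
  convert! h1.clog hs using 1
  have := sub_one_ne_zero_of_mem_closedQuadrant hu
  field_simp

lemma hasDerivAt_log_add_one {u : ℂ} (hu : u ∈ closedQuadrant) :
    HasDerivAt (fun u => log (u + 1)) (1 / (u + 1)) u := by
  refine ((hasDerivAt_id u).add_const 1).clog ?_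
  rw [mem_slitPlane_iff]
  left
  simp
  linarith [hu.2.1]

lemma log_neg_I_mul_sub_one_im {a : ℝ} (ha : 1 < a) :
    (log (-I * ((a : ℂ) - 1))).im = -(Real.pi / 2) := by
  rw [log_im, show -I * ((a : ℂ) - 1) = ((a - 1 : ℝ) : ℂ) * -I by push_cast; ring,
    arg_real_mul _ (by linarith), arg_neg_I]

lemma log_ofReal_add_one_im {a : ℝ} (ha : 0 ≤ a) : (log ((a : ℂ) + 1)).im = 0 := by
  rw [log_im, show (a : ℂ) + 1 = ((a + 1 : ℝ) : ℂ) by push_cast; ring,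
    arg_ofReal_of_nonneg (by linarith)]

/-- `f` has a primitive `F` on `closedQuadrant` with `Im F(0) - Im F(a) = c` for all real `a > 1`;
thus `c` is the imaginary part of the integral of `f` along any path from `a` to `0` in the
quadrant. -/
def HasPrimitiveIncrement (f : ℂ → ℂ) (c : ℝ) : Prop :=
  ∃ F : ℂ → ℂ, (∀ u ∈ closedQuadrant, HasDerivAt F (f u) u) ∧
    ∀ a : ℝ, 1 < a → (F 0).im - (F a).im = c

/-- The contribution `π · Res` of the simple pole `1`, with residue `1 / 2`. It does not
depend on `k`, since
`u ^ (k + 2) / (u² - 1) = u ^ k + u ^ k / (u² - 1)` and the first term is real on the real axis. -/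
lemma hasPrimitiveIncrement_pow_div_one (k : ℕ) :
    HasPrimitiveIncrement (fun u => u ^ k / (u ^ 2 - 1) ^ 1) (Real.pi / 2) := by
  induction k using Nat.twoStepInduction with
  | zero =>
    refine ⟨fun u => 1 / 2 * (log (-I * (u - 1)) - log (u + 1)), fun u hu => ?_, fun a ha => ?_⟩
    · convert! ((hasDerivAt_log_sub_one hu).sub (hasDerivAt_log_add_one hu)).const_mul (1 / 2 : ℂ)
        using 1
      have h1 := sub_one_ne_zero_of_mem_closedQuadrant hu
      have h2 := add_one_ne_zero_of_mem_closedQuadrant hu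
      dsimp only
      rw [show u ^ 2 - 1 = (u - 1) * (u + 1) by ring]
      field_simp
      ring
    · have e : ∀ z : ℂ, (1 / 2 * z).im = z.im / 2 := fun z => by simp; ring
      simp only [e, sub_im, log_neg_I_mul_sub_one_im ha,
        log_ofReal_add_one_im (by linarith : 0 ≤ a)]
      simp [log_im]
      ring
  | one =>
    refine ⟨fun u => 1 / 2 * (log (-I * (u - 1)) + log (u + 1)), fun u hu => ?_, fun a ha => ?_⟩
    · convert! ((hasDerivAt_log_sub_one hu).add (hasDerivAt_log_add_one hu)).const_mul (1 / 2 : ℂ)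
        using 1
      have h1 := sub_one_ne_zero_of_mem_closedQuadrant hu
      have h2 := add_one_ne_zero_of_mem_closedQuadrant hu
      dsimp only
      rw [show u ^ 2 - 1 = (u - 1) * (u + 1) by ring]
      field_simp
      ring
    · have e : ∀ z : ℂ, (1 / 2 * z).im = z.im / 2 := fun z => by simp; ring
      simp only [e, add_im, log_neg_I_mul_sub_one_im ha,
        log_ofReal_add_one_im (by linarith : 0 ≤ a)]
      simp [log_im]
      ring
  | more k ih _ =>
    obtain ⟨F, hF, hF'⟩ := ih
    refine ⟨fun u => u ^ (k + 1) / (k + 1) + F u, fun u hu => ?_, fun a ha => ?_⟩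
    · convert! ((hasDerivAt_pow (k + 1) u).div_const ((k : ℂ) + 1)).add (hF u hu) using 1
      have h1 := sq_sub_one_ne_zero_of_mem_closedQuadrant hu
      have hk : (k : ℂ) + 1 ≠ 0 := by exact_mod_cast k.succ_ne_zero
      push_cast
      field_simp
      ring
    · have : ((a : ℂ) ^ (k + 1) / (k + 1)) = ((a ^ (k + 1) / (k + 1) : ℝ) : ℂ) := by push_cast; rfl
      rw [add_im, add_im, this, ofReal_im]
      simpa using hF' a ha

/-- Lowering the order of the pole: the derivative of `u ^ (k + 1) / (u² - 1) ^ (m + 1)` is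
`(k + 1) u ^ k / (u² - 1) ^ (m + 1) - 2 (m + 1) u ^ (k + 2) / (u² - 1) ^ (m + 2)`. -/
lemma hasPrimitiveIncrement_pow_div_pow (m k : ℕ) (hk : 2 * m ≤ k) :
    HasPrimitiveIncrement (fun u => u ^ k / (u ^ 2 - 1) ^ (m + 1))
      (Real.pi / 2 * Ring.choose (((k : ℝ) - 1) / 2) m) := by
  induction m generalizing k with
  | zero => simpa using hasPrimitiveIncrement_pow_div_one k
  | succ m ih =>
    obtain ⟨k, rfl⟩ : ∃ j, k = j + 2 := ⟨k - 2, by omega⟩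
    obtain ⟨F, hF, hF'⟩ := ih k (by omega)
    have hm : (m : ℂ) + 1 ≠ 0 := by exact_mod_cast m.succ_ne_zero
    refine ⟨fun u => (((k + 1) / (2 * (m + 1)) : ℝ) : ℂ) * F u -
      (1 / (2 * (m + 1)) : ℝ) * (u ^ (k + 1) / (u ^ 2 - 1) ^ (m + 1)), fun u hu => ?_,
      fun a ha => ?_⟩
    · have h1 := sq_sub_one_ne_zero_of_mem_closedQuadrant hu
      have h2 : HasDerivAt (fun u : ℂ => u ^ 2 - 1) (2 * u) u := by
        simpa using (hasDerivAt_pow 2 u).sub_const 1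
      convert! ((hF u hu).const_mul _).sub
        (((hasDerivAt_pow (k + 1) u).div (h2.fun_pow (m + 1))
          (pow_ne_zero _ h1)).const_mul _) using 1
      push_cast
      field_simp
      ring
    · have : ((a : ℂ) ^ (k + 1) / ((a : ℂ) ^ 2 - 1) ^ (m + 1)) =
        ((a ^ (k + 1) / (a ^ 2 - 1) ^ (m + 1) : ℝ) : ℂ) := by push_cast; rfl
      rw [sub_im, sub_im, this, im_ofReal_mul, im_ofReal_mul, ← ofReal_mul, ofReal_im,
        eq_add_of_sub_eq (hF' a ha)]
      have e : (((k + 2 : ℕ) : ℝ) - 1) / 2 = ((k : ℝ) - 1) / 2 + 1 := by push_cast; ring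
      rw [e, Ring.choose_add_one_succ]
      have hm' : (m : ℝ) + 1 ≠ 0 := by positivity
      have h0 : ((0 : ℂ) ^ (k + 1) / ((0 : ℂ) ^ 2 - 1) ^ (m + 1)) = 0 := by simp
      rw [h0, zero_im, im_ofReal_mul]
      field_simp
      ring

/-! ### The curve `u(φ)` and the coordinate change `σ` -/

section Curve

variable {r : ℕ} {φ : ℝ}

lemma angle_bound (hr : 1 < r) (hφ : φ ∈ Ioc 0 (Real.pi / ((r : ℝ) + 1))) :
    ((r : ℝ) + 1) * φ ≤ Real.pi ∧ 2 ≤ (r : ℝ) ∧ 0 < φ := by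
  have h2 : (2 : ℝ) ≤ r := by exact_mod_cast hr
  refine ⟨?_, h2, hφ.1⟩
  have := (le_div_iff₀ (by linarith : (0 : ℝ) < r + 1)).1 hφ.2
  linarith

lemma sin_sub_one_mul_pos (hr : 1 < r) (hφ : φ ∈ Ioc 0 (Real.pi / ((r : ℝ) + 1))) :
    0 < Real.sin (((r : ℝ) - 1) * φ) := by
  obtain ⟨h1, h2, h3⟩ := angle_bound hr hφ
  exact Real.sin_pos_of_pos_of_lt_pi (by nlinarith) (by nlinarith)

lemma sin_two_mul_pos (hr : 1 < r) (hφ : φ ∈ Ioc 0 (Real.pi / ((r : ℝ) + 1))) :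
    0 < Real.sin (2 * φ) := by
  obtain ⟨h1, h2, h3⟩ := angle_bound hr hφ
  exact Real.sin_pos_of_pos_of_lt_pi (by nlinarith) (by nlinarith)

lemma sin_angle_pos (hr : 1 < r) (hφ : φ ∈ Ioc 0 (Real.pi / ((r : ℝ) + 1))) :
    0 < Real.sin φ := by
  obtain ⟨h1, h2, h3⟩ := angle_bound hr hφ
  exact Real.sin_pos_of_pos_of_lt_pi (by nlinarith) (by nlinarith)

lemma cos_angle_pos (hr : 1 < r) (hφ : φ ∈ Ioc 0 (Real.pi / ((r : ℝ) + 1))) :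
    0 < Real.cos φ := by
  obtain ⟨h1, h2, h3⟩ := angle_bound hr hφ
  exact Real.cos_pos_of_mem_Ioo ⟨by linarith [Real.pi_pos], by nlinarith⟩

lemma sin_add_one_mul_pos (hr : 1 < r) (hφ : φ ∈ Ioo 0 (Real.pi / ((r : ℝ) + 1))) :
    0 < Real.sin (((r : ℝ) + 1) * φ) := by
  obtain ⟨h1, h2, h3⟩ := angle_bound hr (Ioo_subset_Ioc_self hφ)
  refine Real.sin_pos_of_pos_of_lt_pi (by nlinarith) ?_
  have := (lt_div_iff₀ (by linarith : (0 : ℝ) < r + 1)).1 hφ.2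
  linarith

variable (r φ) in
/-- The modulus `√(sin ((r + 1) φ) / sin ((r - 1) φ))` of the point of the curve at angle `φ`. -/
noncomputable def raneyRadius : ℝ :=
  Real.sqrt (Real.sin (((r : ℝ) + 1) * φ) / Real.sin (((r : ℝ) - 1) * φ))

variable (r φ) in
/-- The point `u(φ)` of the curve, in polar form with argument `φ`. -/
noncomputable def raneyCurve : ℂ :=
  raneyRadius r φ * exp (φ * I)

lemma raneyRadius_pos (hr : 1 < r) (hφ : φ ∈ Ioo 0 (Real.pi / ((r : ℝ) + 1))) :
    0 < raneyRadius r φ :=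
  Real.sqrt_pos.2 (div_pos (sin_add_one_mul_pos hr hφ)
    (sin_sub_one_mul_pos hr (Ioo_subset_Ioc_self hφ)))

lemma raneyRadius_sq (hr : 1 < r) (hφ : φ ∈ Ioo 0 (Real.pi / ((r : ℝ) + 1))) :
    raneyRadius r φ ^ 2 = Real.sin (((r : ℝ) + 1) * φ) / Real.sin (((r : ℝ) - 1) * φ) :=
  Real.sq_sqrt (div_pos (sin_add_one_mul_pos hr hφ)
    (sin_sub_one_mul_pos hr (Ioo_subset_Ioc_self hφ))).le

lemma raneyCurve_re : (raneyCurve r φ).re = raneyRadius r φ * Real.cos φ := by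
  simp [raneyCurve, exp_ofReal_mul_I_re]

lemma raneyCurve_im : (raneyCurve r φ).im = raneyRadius r φ * Real.sin φ := by
  simp [raneyCurve, exp_ofReal_mul_I_im]

lemma raneyCurve_mem_closedQuadrant (hr : 1 < r)
    (hφ : φ ∈ Ioo 0 (Real.pi / ((r : ℝ) + 1))) : raneyCurve r φ ∈ closedQuadrant := by
  have h := raneyRadius_pos hr hφ
  have h1 := mul_pos h (sin_angle_pos hr (Ioo_subset_Ioc_self hφ))
  have h2 := mul_pos h (cos_angle_pos hr (Ioo_subset_Ioc_self hφ))
  rw [← raneyCurve_im] at h1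
  rw [← raneyCurve_re] at h2
  refine ⟨h1.le, h2.le, fun h => ?_⟩
  rw [h] at h1
  simp at h1

lemma raneySigma_eq_raneyRadius_pow (hr : 1 < r)
    (hφ : φ ∈ Ioo 0 (Real.pi / ((r : ℝ) + 1))) :
    raneySigma r φ =
      raneyRadius r φ ^ (r + 1) * Real.sin (((r : ℝ) - 1) * φ) / Real.sin (2 * φ) := by
  have h1 := sin_add_one_mul_pos hr hφ
  have h2 := sin_sub_one_mul_pos hr (Ioo_subset_Ioc_self hφ)
  have h3 := sin_two_mul_pos hr (Ioo_subset_Ioc_self hφ)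
  have e : ∀ x : ℝ, 0 < x → x ^ (((r : ℝ) + 1) / 2) = Real.sqrt x ^ (r + 1) := by
    intro x hx
    rw [Real.sqrt_eq_rpow, ← Real.rpow_natCast, ← Real.rpow_mul hx.le]
    congr 1
    push_cast
    ring
  have e' : ∀ x : ℝ, 0 < x → x ^ (((r : ℝ) - 1) / 2) = Real.sqrt x ^ (r + 1) / x := by
    intro x hx
    rw [← e x hx, show ((r : ℝ) - 1) / 2 = (r + 1) / 2 - 1 by ring, Real.rpow_sub_one hx.ne']
  rw [raneySigma, raneyRadius, e _ h1, e' _ h2, Real.sqrt_div h1.le, div_pow]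
  have h4 := pow_ne_zero (r + 1) (Real.sqrt_pos.2 h2).ne'
  field_simp

lemma raneySigma_pos (hr : 1 < r) (hφ : φ ∈ Ioo 0 (Real.pi / ((r : ℝ) + 1))) :
    0 < raneySigma r φ := by
  rw [raneySigma_eq_raneyRadius_pow hr hφ]
  have h1 := raneyRadius_pos hr hφ
  have h2 := sin_sub_one_mul_pos hr (Ioo_subset_Ioc_self hφ)
  have h3 := sin_two_mul_pos hr (Ioo_subset_Ioc_self hφ)
  positivity

/-- The instance `sin A e^{iB} - sin (A - B) = sin B e^{iA}` with `A = (r + 1) φ`, `B = 2 φ`. -/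
lemma raneyCurve_sq_sub_one (hr : 1 < r) (hφ : φ ∈ Ioo 0 (Real.pi / ((r : ℝ) + 1))) :
    raneyCurve r φ ^ 2 - 1 =
      ((Real.sin (2 * φ) / Real.sin (((r : ℝ) - 1) * φ) : ℝ) : ℂ) * exp (φ * I) ^ (r + 1) := by
  have h2 := sin_sub_one_mul_pos hr (Ioo_subset_Ioc_self hφ)
  have hs : Real.sin (((r : ℝ) - 1) * φ) = Real.sin (((r : ℝ) + 1) * φ) * Real.cos (2 * φ) -
      Real.cos (((r : ℝ) + 1) * φ) * Real.sin (2 * φ) := by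
    rw [← Real.sin_sub]
    congr 1
    ring
  have e1 : exp (φ * I) ^ 2 = exp ((2 * φ : ℝ) * I) := by
    rw [← exp_nat_mul]
    congr 1
    push_cast
    ring
  have e2 : exp (φ * I) ^ (r + 1) = exp ((((r : ℝ) + 1) * φ : ℝ) * I) := by
    rw [← exp_nat_mul]
    congr 1
    push_cast
    ring
  rw [raneyCurve, mul_pow, ← ofReal_pow, raneyRadius_sq hr hφ, e1, e2]
  apply Complex.ext
  · rw [sub_re, re_ofReal_mul, re_ofReal_mul, exp_ofReal_mul_I_re, exp_ofReal_mul_I_re, one_re]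
    generalize Real.sin (((r : ℝ) - 1) * φ) = S at *
    generalize Real.sin (2 * φ) = s at *
    field_simp
    rw [mul_comm φ 2]
    linarith
  · rw [sub_im, im_ofReal_mul, im_ofReal_mul, exp_ofReal_mul_I_im, exp_ofReal_mul_I_im, one_im]
    ring

/-- On the curve, `u ^ (r + 1) / (u² - 1)` is real and equal to `σ`. -/
lemma raneySigma_mul_sq_sub_one (hr : 1 < r) (hφ : φ ∈ Ioo 0 (Real.pi / ((r : ℝ) + 1))) :
    (raneySigma r φ : ℂ) * (raneyCurve r φ ^ 2 - 1) = raneyCurve r φ ^ (r + 1) := by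
  have h2 := sin_sub_one_mul_pos hr (Ioo_subset_Ioc_self hφ)
  have h3 := sin_two_mul_pos hr (Ioo_subset_Ioc_self hφ)
  rw [raneyCurve_sq_sub_one hr hφ, ← mul_assoc, ← ofReal_mul, raneyCurve, mul_pow, ← ofReal_pow,
    raneySigma_eq_raneyRadius_pow hr hφ]
  generalize Real.sin (((r : ℝ) - 1) * φ) = S at *
  generalize Real.sin (2 * φ) = s at *
  congr 2
  field_simp

lemma hasDerivAt_raneyCurve (hr : 1 < r) (hφ : φ ∈ Ioo 0 (Real.pi / ((r : ℝ) + 1))) :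
    HasDerivAt (raneyCurve r) (deriv (raneyCurve r) φ) φ := by
  have h1 := sin_add_one_mul_pos hr hφ
  have h2 := sin_sub_one_mul_pos hr (Ioo_subset_Ioc_self hφ)
  have h3 : DifferentiableAt ℝ (raneyRadius r) φ :=
    DifferentiableAt.sqrt (by fun_prop (disch := exact h2.ne')) (div_pos h1 h2).ne'
  have h4 : DifferentiableAt ℝ (fun φ : ℝ => (raneyRadius r φ : ℂ)) φ :=
    h3.hasDerivAt.ofReal_comp.differentiableAt
  have h5 : DifferentiableAt ℝ (fun φ : ℝ => exp (φ * I)) φ :=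
    ((ofRealCLM.differentiableAt (x := φ)).mul_const I).cexp
  exact (h4.mul h5).hasDerivAt

/-- With `a = r - 1`, `A = a φ`, `B = 2 φ`, the sign of `σ'` comes from the identity
`(a ^ 2 cot A + 4 cot B - (a + 2) ^ 2 cot (A + B)) (cot A + cot B) =
(a cot A - 2 cot B) ^ 2 + (a + 2) ^ 2`, cleared of denominators. -/
lemma hasDerivAt_raneySigma (hr : 1 < r) (hφ : φ ∈ Ioo 0 (Real.pi / ((r : ℝ) + 1))) :
    HasDerivAt (raneySigma r) (deriv (raneySigma r) φ) φ ∧ deriv (raneySigma r) φ < 0 := by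
  have h1 := sin_add_one_mul_pos hr hφ
  have h2 := sin_sub_one_mul_pos hr (Ioo_subset_Ioc_self hφ)
  have h3 := sin_two_mul_pos hr (Ioo_subset_Ioc_self hφ)
  have hs : ∀ c : ℝ, HasDerivAt (fun φ => Real.sin (c * φ)) (Real.cos (c * φ) * c) φ := by
    intro c
    simpa using ((hasDerivAt_id φ).const_mul c).sin
  have hd := ((((hs (r + 1)).log h1.ne').const_mul (((r : ℝ) + 1) / 2)).sub
    (((hs 2).log h3.ne').add (((hs (r - 1)).log h2.ne').const_mul (((r : ℝ) - 1) / 2)))).exp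
  have heq : raneySigma r =ᶠ[𝓝 φ] fun φ => Real.exp (((r : ℝ) + 1) / 2 *
      Real.log (Real.sin ((r + 1) * φ)) - (Real.log (Real.sin (2 * φ)) +
        ((r : ℝ) - 1) / 2 * Real.log (Real.sin ((r - 1) * φ)))) := by
    filter_upwards [isOpen_Ioo.mem_nhds hφ] with ψ hψ
    have h1 := sin_add_one_mul_pos hr hψ
    have h2 := sin_sub_one_mul_pos hr (Ioo_subset_Ioc_self hψ)
    have h3 := sin_two_mul_pos hr (Ioo_subset_Ioc_self hψ)
    rw [raneySigma, Real.rpow_def_of_pos h1, Real.rpow_def_of_pos h2, Real.exp_sub, Real.exp_add,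
      Real.exp_log h3, mul_comm (Real.log _), mul_comm (Real.log _)]
  have hd' := hd.congr_of_eventuallyEq heq
  refine ⟨hd'.differentiableAt.hasDerivAt, ?_⟩
  rw [hd'.deriv]
  refine mul_neg_of_pos_of_neg (Real.exp_pos _) ?_
  have e1 : Real.sin (((r : ℝ) + 1) * φ) = Real.sin (((r : ℝ) - 1) * φ) * Real.cos (2 * φ) +
      Real.cos (((r : ℝ) - 1) * φ) * Real.sin (2 * φ) := by
    rw [← Real.sin_add]
    congr 1
    ring
  have e2 : Real.cos (((r : ℝ) + 1) * φ) = Real.cos (((r : ℝ) - 1) * φ) * Real.cos (2 * φ) -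
      Real.sin (((r : ℝ) - 1) * φ) * Real.sin (2 * φ) := by
    rw [← Real.cos_add]
    congr 1
    ring
  rw [e2]
  obtain ⟨-, hr2, -⟩ := angle_bound hr (Ioo_subset_Ioc_self hφ)
  generalize Real.sin (((r : ℝ) + 1) * φ) = T at *
  generalize Real.sin (((r : ℝ) - 1) * φ) = S at *
  generalize Real.cos (((r : ℝ) - 1) * φ) = C at *
  generalize Real.sin (2 * φ) = s at *
  generalize Real.cos (2 * φ) = c at *
  have key : ((r : ℝ) + 1) / 2 * ((C * c - S * s) * (r + 1) / T) -
      (c * 2 / s + ((r : ℝ) - 1) / 2 * (C * (r - 1) / S)) =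
      -(((r - 1) * C * s - 2 * c * S) ^ 2 + ((r + 1) * S * s) ^ 2) /
        (2 * T * s * S) := by
    field_simp
    rw [e1]
    ring
  rw [key]
  refine div_neg_of_neg_of_pos (neg_lt_zero.2 ?_) (by positivity)
  have : 0 < ((r : ℝ) + 1) * S * s := by positivity
  positivity

lemma tendsto_sin_mul_div (c : ℝ) :
    Tendsto (fun φ => Real.sin (c * φ) / φ) (𝓝[>] 0) (𝓝 c) := by
  have h : HasDerivAt (fun φ => Real.sin (c * φ)) c 0 := by
    simpa using ((hasDerivAt_id (0 : ℝ)).const_mul c).sin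
  have h' := (hasDerivAt_iff_tendsto_slope_zero.1 h).mono_left
    (nhdsWithin_mono 0 fun x (hx : 0 < x) => hx.ne')
  refine h'.congr fun t => ?_
  simp [div_eq_inv_mul]

lemma tendsto_sin_mul_div_sin_mul (c : ℝ) {d : ℝ} (hd : d ≠ 0) :
    Tendsto (fun φ => Real.sin (c * φ) / Real.sin (d * φ)) (𝓝[>] 0) (𝓝 (c / d)) := by
  refine ((tendsto_sin_mul_div c).div (tendsto_sin_mul_div d) hd).congr' ?_
  filter_upwards [self_mem_nhdsWithin] with φ hφ
  have : φ ≠ 0 := ne_of_gt hφ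
  simp only [Pi.div_apply]
  rw [div_div_div_cancel_right₀ this]

lemma tendsto_raneyRadius_zero (hr : 1 < r) :
    Tendsto (raneyRadius r) (𝓝[>] 0) (𝓝 (Real.sqrt (((r : ℝ) + 1) / (r - 1)))) := by
  have h2 : (2 : ℝ) ≤ r := by exact_mod_cast hr
  exact (tendsto_sin_mul_div_sin_mul _ (by linarith)).sqrt

lemma right_mem_Ioc : Real.pi / ((r : ℝ) + 1) ∈ Ioc 0 (Real.pi / ((r : ℝ) + 1)) := by
  have := Real.pi_pos
  exact ⟨by positivity, le_rfl⟩

lemma tendsto_raneyRadius_right (hr : 1 < r) :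
    Tendsto (raneyRadius r) (𝓝[<] (Real.pi / ((r : ℝ) + 1))) (𝓝 0) := by
  have h2 := sin_sub_one_mul_pos hr right_mem_Ioc
  have h : ContinuousAt (raneyRadius r) (Real.pi / ((r : ℝ) + 1)) := by
    unfold raneyRadius
    fun_prop (disch := exact h2.ne')
  have h0 : raneyRadius r (Real.pi / ((r : ℝ) + 1)) = 0 := by
    have : (r : ℝ) + 1 ≠ 0 := by positivity
    rw [raneyRadius, mul_div_cancel₀ _ this]
    simp
  rw [ContinuousAt, h0] at h
  exact h.mono_left nhdsWithin_le_nhds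

lemma tendsto_exp_mul_I (a : ℝ) (s : Set ℝ) :
    Tendsto (fun φ : ℝ => exp (φ * I)) (𝓝[s] a) (𝓝 (exp (a * I))) :=
  ((by fun_prop : Continuous fun φ : ℝ => exp (φ * I)).tendsto a).mono_left nhdsWithin_le_nhds

lemma tendsto_raneyCurve_zero (hr : 1 < r) :
    Tendsto (raneyCurve r) (𝓝[>] 0) (𝓝 (Real.sqrt (((r : ℝ) + 1) / (r - 1)) : ℝ)) := by
  simpa [raneyCurve, Function.comp_def] using!
    ((continuous_ofReal.tendsto _).comp (tendsto_raneyRadius_zero hr)).mul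
    (tendsto_exp_mul_I 0 (Ioi 0))

lemma tendsto_raneyCurve_right (hr : 1 < r) :
    Tendsto (raneyCurve r) (𝓝[<] (Real.pi / ((r : ℝ) + 1))) (𝓝 0) := by
  simpa [raneyCurve, Function.comp_def] using!
    ((continuous_ofReal.tendsto _).comp (tendsto_raneyRadius_right hr)).mul
    (tendsto_exp_mul_I _ _)

lemma Ioo_mem_nhdsGT_zero : Ioo 0 (Real.pi / ((r : ℝ) + 1)) ∈ 𝓝[>] (0 : ℝ) :=
  Ioo_mem_nhdsGT right_mem_Ioc.1

lemma Ioo_mem_nhdsLT_right :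
    Ioo 0 (Real.pi / ((r : ℝ) + 1)) ∈ 𝓝[<] (Real.pi / ((r : ℝ) + 1)) :=
  Ioo_mem_nhdsLT right_mem_Ioc.1

lemma tendsto_raneySigma_zero (hr : 1 < r) :
    Tendsto (raneySigma r) (𝓝[>] 0) (𝓝 (raneyEndpoint r)) := by
  have h2 : (2 : ℝ) ≤ r := by exact_mod_cast hr
  have h := ((tendsto_raneyRadius_zero hr).pow (r + 1)).mul
    (tendsto_sin_mul_div_sin_mul ((r : ℝ) - 1) two_ne_zero)
  have e : raneyEndpoint r = Real.sqrt (((r : ℝ) + 1) / (r - 1)) ^ (r + 1) * ((r - 1) / 2) := by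
    have hp : (0 : ℝ) < r + 1 := by linarith
    have hm : (0 : ℝ) < r - 1 := by linarith
    rw [raneyEndpoint, Real.sqrt_eq_rpow, ← Real.rpow_natCast, ← Real.rpow_mul (by positivity),
      Real.div_rpow hp.le hm.le,
      show 1 / 2 * ((r + 1 : ℕ) : ℝ) = ((r : ℝ) - 1) / 2 + 1 by push_cast; ring,
      Real.rpow_add_one hm.ne', show ((r : ℝ) - 1) / 2 + 1 = (r + 1) / 2 by ring]
    field_simp
  rw [e]
  refine h.congr' ?_
  filter_upwards [Ioo_mem_nhdsGT_zero] with φ hφ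
  rw [raneySigma_eq_raneyRadius_pow hr hφ, mul_div_assoc]

lemma tendsto_raneySigma_right (hr : 1 < r) :
    Tendsto (raneySigma r) (𝓝[<] (Real.pi / ((r : ℝ) + 1))) (𝓝 0) := by
  have h3 := sin_two_mul_pos hr right_mem_Ioc
  have hc : ContinuousAt (fun φ => Real.sin (((r : ℝ) - 1) * φ) / Real.sin (2 * φ))
      (Real.pi / ((r : ℝ) + 1)) := by
    fun_prop (disch := exact h3.ne')
  have h := ((tendsto_raneyRadius_right hr).pow (r + 1)).mul
    (hc.tendsto.mono_left nhdsWithin_le_nhds)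
  rw [zero_pow (by omega), zero_mul] at h
  refine h.congr' ?_
  filter_upwards [Ioo_mem_nhdsLT_right] with φ hφ
  rw [raneySigma_eq_raneyRadius_pow hr hφ, mul_div_assoc]

lemma continuousOn_raneySigma (hr : 1 < r) :
    ContinuousOn (raneySigma r) (Ioo 0 (Real.pi / ((r : ℝ) + 1))) :=
  fun _ hφ => (hasDerivAt_raneySigma hr hφ).1.continuousAt.continuousWithinAt

lemma strictAntiOn_raneySigma (hr : 1 < r) :
    StrictAntiOn (raneySigma r) (Ioo 0 (Real.pi / ((r : ℝ) + 1))) := by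
  refine strictAntiOn_of_deriv_neg (convex_Ioo _ _) (continuousOn_raneySigma hr) fun φ hφ => ?_
  rw [interior_Ioo] at hφ
  exact (hasDerivAt_raneySigma hr hφ).2

lemma bijOn_Ioo_of_strictAntiOn {f : ℝ → ℝ} {a b c d : ℝ} (hab : a < b)
    (hf : StrictAntiOn f (Ioo a b)) (hc : ContinuousOn f (Ioo a b))
    (ha : Tendsto f (𝓝[>] a) (𝓝 d)) (hb : Tendsto f (𝓝[<] b) (𝓝 c)) :
    BijOn f (Ioo a b) (Ioo c d) := by
  refine ⟨fun x hx => ⟨?_, ?_⟩, hf.injOn, fun y hy => ?_⟩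
  · obtain ⟨z, hz⟩ := exists_between hx.2
    refine lt_of_le_of_lt (le_of_tendsto hb ?_) (hf hx ⟨hx.1.trans hz.1, hz.2⟩ hz.1)
    filter_upwards [Ioo_mem_nhdsLT hz.2] with w hw
    exact (hf ⟨hx.1.trans hz.1, hz.2⟩ ⟨hx.1.trans (hz.1.trans hw.1), hw.2⟩ hw.1).le
  · obtain ⟨z, hz⟩ := exists_between hx.1
    refine lt_of_lt_of_le (hf ⟨hz.1, hz.2.trans hx.2⟩ hx hz.2) (ge_of_tendsto ha ?_)
    filter_upwards [Ioo_mem_nhdsGT hz.1] with w hw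
    exact (hf ⟨hw.1, hw.2.trans (hz.2.trans hx.2)⟩ ⟨hz.1, hz.2.trans hx.2⟩ hw.2).le
  · obtain ⟨p, hp, hp'⟩ := ((ha.eventually_const_lt hy.2).and (Ioo_mem_nhdsGT hab)).exists
    obtain ⟨q, hq, hq'⟩ := ((hb.eventually_lt_const hy.1).and (Ioo_mem_nhdsLT hab)).exists
    exact isPreconnected_Ioo.intermediate_value hq' hp' hc ⟨hq.le, hp.le⟩

lemma bijOn_raneySigma (hr : 1 < r) :
    BijOn (raneySigma r) (Ioo 0 (Real.pi / ((r : ℝ) + 1))) (Ioo 0 (raneyEndpoint r)) :=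
  bijOn_Ioo_of_strictAntiOn right_mem_Ioc.1 (strictAntiOn_raneySigma hr)
    (continuousOn_raneySigma hr) (tendsto_raneySigma_zero hr) (tendsto_raneySigma_right hr)

end Curve

/-! ### Moments and distribution function in the coordinate `φ` -/

lemma I_mul_add_one_div_sub_one (u : ℂ) :
    I * (u + 1) / (u - 1) =
      (((normSq (u - 1))⁻¹ : ℝ) : ℂ) * (((2 * u.im : ℝ) : ℂ) + ((normSq u - 1 : ℝ) : ℂ) * I) := by
  rw [div_eq_mul_inv, inv_def, ← mul_assoc, mul_comm]
  congr 1
  apply Complex.ext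
  · simp [normSq_apply]
    ring
  · simp [normSq_apply]
    ring

lemma hasDerivAt_log_cayley {u : ℂ} (hu : u ∈ closedQuadrant) :
    HasDerivAt (fun u => log (I * (u + 1) / (u - 1))) (-(2 / (u ^ 2 - 1))) u := by
  have h1 := sub_one_ne_zero_of_mem_closedQuadrant hu
  have h2 := add_one_ne_zero_of_mem_closedQuadrant hu
  have h3 := sq_sub_one_ne_zero_of_mem_closedQuadrant hu
  have hs : I * (u + 1) / (u - 1) ∈ slitPlane := by
    rw [I_mul_add_one_div_sub_one, mem_slitPlane_iff, re_ofReal_mul, im_ofReal_mul]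
    have hn : 0 < (normSq (u - 1))⁻¹ := inv_pos.2 (normSq_pos.2 h1)
    rcases hu.1.lt_or_eq with h | h
    · left
      refine mul_pos hn ?_
      simpa using h
    · right
      refine mul_ne_zero hn.ne' ?_
      have hre : u = (u.re : ℂ) := Complex.ext (by simp) (by simp [← h])
      have : ((normSq u - 1 : ℝ) : ℂ) = u ^ 2 - 1 := by
        rw [hre, normSq_ofReal]
        push_cast
        ring
      intro h'
      have h4 : normSq u - 1 = 0 := by simpa using h'
      rw [h4, ofReal_zero] at this
      exact h3 this.symm
  convert! ((((hasDerivAt_id u).add_const 1).const_mul I).div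
    ((hasDerivAt_id u).sub_const 1) h1).clog hs using 1
  have hI := I_ne_zero
  simp only [id, Pi.div_apply]
  rw [show u ^ 2 - 1 = (u - 1) * (u + 1) by ring]
  field_simp
  ring

lemma log_im_eq_arctan {z : ℂ} (hz : 0 < z.re) : (log z).im = Real.arctan (z.im / z.re) := by
  have h := abs_lt.1 (abs_arg_lt_pi_div_two_iff.2 (Or.inl hz))
  rw [log_im, ← tan_arg, Real.arctan_tan h.1 h.2]

section Distribution

variable {r : ℕ} {φ : ℝ}

variable (r φ) in
/-- The density `-σ'(φ) v(σ(φ))` of the Raney distribution in the coordinate `φ`, where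
`v(σ(φ)) = Im u(φ) / (π σ(φ))`. -/
noncomputable def raneyWeight : ℝ :=
  -deriv (raneySigma r) φ * (raneyCurve r φ).im / (Real.pi * raneySigma r φ)

lemma raneyCurve_im_pos (hr : 1 < r) (hφ : φ ∈ Ioo 0 (Real.pi / ((r : ℝ) + 1))) :
    0 < (raneyCurve r φ).im := by
  rw [raneyCurve_im]
  exact mul_pos (raneyRadius_pos hr hφ) (sin_angle_pos hr (Ioo_subset_Ioc_self hφ))

lemma raneyWeight_nonneg (hr : 1 < r) (hφ : φ ∈ Ioo 0 (Real.pi / ((r : ℝ) + 1))) :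
    0 ≤ raneyWeight r φ := by
  have h1 := (hasDerivAt_raneySigma hr hφ).2
  have h2 := raneySigma_pos hr hφ
  have h3 := raneyCurve_im_pos hr hφ
  exact div_nonneg (mul_nonneg (by linarith) h3.le) (mul_nonneg Real.pi_pos.le h2.le)

lemma HasDerivAt.complex_im {f : ℝ → ℂ} {f' : ℂ} {x : ℝ} (h : HasDerivAt f f' x) :
    HasDerivAt (fun x => (f x).im) f'.im x :=
  imCLM.hasFDerivAt.comp_hasDerivAt x h

variable (r φ) in
/-- A primitive of `raneyWeight`: up to the sign and the factor `π`, the imaginary part of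
`(r - 1) u + log (I (u + 1) / (u - 1))`. The factor `I` puts the argument of the logarithm into the
right half plane. It increases from `-1 / 2` to `1 / 2`. -/
noncomputable def raneyCdfPrimitive : ℝ :=
  -(((r : ℂ) - 1) * raneyCurve r φ + log (I * (raneyCurve r φ + 1) / (raneyCurve r φ - 1))).im /
    Real.pi

/-- Logarithmic differentiation of `σ (u² - 1) = u ^ (r + 1)` gives
`(σ' / σ) u = ((r - 1) - 2 / (u² - 1)) u'`, whose imaginary part is the claim. -/
lemma hasDerivAt_raneyCdfPrimitive (hr : 1 < r)
    (hφ : φ ∈ Ioo 0 (Real.pi / ((r : ℝ) + 1))) :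
    HasDerivAt (raneyCdfPrimitive r) (raneyWeight r φ) φ := by
  have hu := raneyCurve_mem_closedQuadrant hr hφ
  have hσ := raneySigma_pos hr hφ
  have hq := sq_sub_one_ne_zero_of_mem_closedQuadrant hu
  have hd := hasDerivAt_raneyCurve hr hφ
  have h := (((hd.const_mul ((r : ℂ) - 1)).add
    ((hasDerivAt_log_cayley hu).scomp φ hd)).complex_im.neg).div_const Real.pi
  refine h.congr_deriv ?_
  -- Both sides of `σ (u² - 1) = u ^ (r + 1)` are differentiated.
  have hrel : HasDerivAt (fun φ => (raneySigma r φ : ℂ) * (raneyCurve r φ ^ 2 - 1))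
      ((r + 1 : ℕ) * raneyCurve r φ ^ r * deriv (raneyCurve r) φ) φ := by
    have := hd.fun_pow (r + 1)
    refine this.congr_of_eventuallyEq ?_
    filter_upwards [isOpen_Ioo.mem_nhds hφ] with ψ hψ
    exact raneySigma_mul_sq_sub_one hr hψ
  have hrel' := ((hasDerivAt_raneySigma hr hφ).1.ofReal_comp).fun_mul ((hd.fun_pow 2).sub_const 1)
  have e := hrel.unique hrel'
  have e0 := raneySigma_mul_sq_sub_one hr hφ
  have hc : (raneySigma r φ : ℂ) ≠ 0 := by exact_mod_cast hσ.ne'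
  have key : ((r : ℂ) - 1) * deriv (raneyCurve r) φ +
      deriv (raneyCurve r) φ • -(2 / (raneyCurve r φ ^ 2 - 1)) =
      ((deriv (raneySigma r) φ / raneySigma r φ : ℝ) : ℂ) * raneyCurve r φ := by
    rw [pow_succ] at e0
    push_cast at e ⊢
    simp only [smul_eq_mul, pow_one] at e ⊢
    field_simp
    linear_combination (raneyCurve r φ) * e + (r + 1) * deriv (raneyCurve r) φ * e0
  rw [key, im_ofReal_mul, raneyWeight]
  have := Real.pi_pos
  field_simp

lemma one_lt_sqrt_endpoint (hr : 1 < r) : 1 < Real.sqrt (((r : ℝ) + 1) / (r - 1)) := by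
  have h2 : (2 : ℝ) ≤ r := by exact_mod_cast hr
  rw [Real.lt_sqrt zero_le_one, lt_div_iff₀ (by linarith)]
  linarith

lemma tendsto_raneyCdfPrimitive_zero (hr : 1 < r) :
    Tendsto (raneyCdfPrimitive r) (𝓝[>] 0) (𝓝 (-(1 / 2))) := by
  have ha := one_lt_sqrt_endpoint hr
  set a := Real.sqrt (((r : ℝ) + 1) / (r - 1)) with ha'
  have hu := ofReal_mem_closedQuadrant ha
  have hc := tendsto_raneyCurve_zero hr
  have h := (((continuous_im.tendsto _).comp ((hc.const_mul ((r : ℂ) - 1)).add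
    ((hasDerivAt_log_cayley hu).continuousAt.tendsto.comp hc))).neg).div_const Real.pi
  have hpos : 0 < (a + 1) / (a - 1) := div_pos (by linarith) (by linarith)
  have e : (((r : ℂ) - 1) * (a : ℂ) + log (I * ((a : ℂ) + 1) / ((a : ℂ) - 1))).im =
      Real.pi / 2 := by
    rw [show I * ((a : ℂ) + 1) / ((a : ℂ) - 1) = (((a + 1) / (a - 1) : ℝ) : ℂ) * I by
      push_cast; ring, add_im, log_im, arg_real_mul _ hpos, arg_I]
    simp
  rw [e] at h
  have hpi := Real.pi_ne_zero
  convert! h using 2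
  field_simp

lemma tendsto_raneyCdfPrimitive_right (hr : 1 < r) :
    Tendsto (raneyCdfPrimitive r) (𝓝[<] (Real.pi / ((r : ℝ) + 1))) (𝓝 (1 / 2)) := by
  have hc := tendsto_raneyCurve_right hr
  have h := (((continuous_im.tendsto _).comp ((hc.const_mul ((r : ℂ) - 1)).add
    ((hasDerivAt_log_cayley zero_mem_closedQuadrant).continuousAt.tendsto.comp
      hc))).neg).div_const Real.pi
  have e : (((r : ℂ) - 1) * 0 + log (I * ((0 : ℂ) + 1) / ((0 : ℂ) - 1))).im =
      -(Real.pi / 2) := by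
    rw [show I * ((0 : ℂ) + 1) / ((0 : ℂ) - 1) = -I by ring, mul_zero, zero_add, log_im, arg_neg_I]
  rw [e] at h
  have hpi := Real.pi_ne_zero
  convert! h using 2
  field_simp

lemma raneyCdfPrimitive_eq (hr : 1 < r) (hφ : φ ∈ Ioo 0 (Real.pi / ((r : ℝ) + 1))) :
    raneyCdfPrimitive r φ = -(((r : ℝ) - 1) * (raneyRadius r φ * Real.sin φ) +
      Real.arctan (Real.cos ((r : ℝ) * φ) /
        Real.sqrt (Real.sin (((r : ℝ) - 1) * φ) * Real.sin (((r : ℝ) + 1) * φ)))) / Real.pi := by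
  have hu := raneyCurve_mem_closedQuadrant hr hφ
  have h1 := sub_one_ne_zero_of_mem_closedQuadrant hu
  have him := raneyCurve_im_pos hr hφ
  have hn : 0 < (normSq (raneyCurve r φ - 1))⁻¹ := inv_pos.2 (normSq_pos.2 h1)
  have hρ := raneyRadius_pos hr hφ
  have hρ2 := raneyRadius_sq hr hφ
  have hp := sin_add_one_mul_pos hr hφ
  have hm := sin_sub_one_mul_pos hr (Ioo_subset_Ioc_self hφ)
  have hs := sin_angle_pos hr (Ioo_subset_Ioc_self hφ)
  have hnorm : normSq (raneyCurve r φ) = raneyRadius r φ ^ 2 := by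
    rw [normSq_apply, raneyCurve_re, raneyCurve_im]
    linear_combination raneyRadius r φ ^ 2 * Real.sin_sq_add_cos_sq φ
  have hsqrt : Real.sqrt (Real.sin (((r : ℝ) - 1) * φ) * Real.sin (((r : ℝ) + 1) * φ)) =
      Real.sin (((r : ℝ) - 1) * φ) * raneyRadius r φ := by
    rw [Real.sqrt_eq_iff_eq_sq (by positivity) (by positivity), mul_pow, hρ2]
    generalize Real.sin (((r : ℝ) - 1) * φ) = S at *
    field_simp
  have hdiff : Real.sin (((r : ℝ) + 1) * φ) - Real.sin (((r : ℝ) - 1) * φ) =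
      2 * Real.cos ((r : ℝ) * φ) * Real.sin φ := by
    rw [show ((r : ℝ) + 1) * φ = r * φ + φ by ring, show ((r : ℝ) - 1) * φ = r * φ - φ by ring,
      Real.sin_add, Real.sin_sub]
    ring
  rw [raneyCdfPrimitive, add_im, log_im_eq_arctan, ← raneyCurve_im]
  · congr 3
    · rw [show (r : ℂ) - 1 = ((r - 1 : ℝ) : ℂ) by push_cast; ring, im_ofReal_mul]
    · rw [I_mul_add_one_div_sub_one, re_ofReal_mul, im_ofReal_mul, mul_div_mul_left _ _ hn.ne',
        hsqrt]
      have e1 : (((2 * (raneyCurve r φ).im : ℝ) : ℂ) +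
        ((normSq (raneyCurve r φ) - 1 : ℝ) : ℂ) * I).im = normSq (raneyCurve r φ) - 1 := by simp
      have e2 : (((2 * (raneyCurve r φ).im : ℝ) : ℂ) +
        ((normSq (raneyCurve r φ) - 1 : ℝ) : ℂ) * I).re = 2 * (raneyCurve r φ).im := by simp
      rw [e1, e2, hnorm, hρ2, raneyCurve_im]
      generalize Real.sin (((r : ℝ) - 1) * φ) = S at *
      generalize Real.sin (((r : ℝ) + 1) * φ) = T at *
      generalize Real.cos ((r : ℝ) * φ) = C at *
      congr 1
      field_simp
      linarith
  · rw [I_mul_add_one_div_sub_one, re_ofReal_mul]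
    refine mul_pos hn ?_
    simpa using him

lemma integrableOn_raneyWeight_Ioo_and_integral (hr : 1 < r)
    (hφ : φ ∈ Ioo 0 (Real.pi / ((r : ℝ) + 1))) :
    IntegrableOn (raneyWeight r) (Ioo φ (Real.pi / ((r : ℝ) + 1))) ∧
      ∫ ψ in Ioo φ (Real.pi / ((r : ℝ) + 1)), raneyWeight r ψ =
        1 / 2 - raneyCdfPrimitive r φ :=
  integrableOn_and_integral_eq_of_hasDerivAt_of_tendsto hφ.2
    (fun _ hψ => hasDerivAt_raneyCdfPrimitive hr ⟨hφ.1.trans hψ.1, hψ.2⟩)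
    (fun _ hψ => raneyWeight_nonneg hr ⟨hφ.1.trans hψ.1, hψ.2⟩)
    ((hasDerivAt_raneyCdfPrimitive hr hφ).continuousAt.tendsto.mono_left nhdsWithin_le_nhds)
    (tendsto_raneyCdfPrimitive_right hr)

lemma raneyNumber_half_zero (α : ℝ) : raneyNumber α (1 / 2) 0 = 1 := by
  simp [raneyNumber]

lemma raneyNumber_half_succ {α : ℝ} (hα : 0 ≤ α) (m : ℕ) :
    raneyNumber α (1 / 2) (m + 1) =
      1 / (2 * (m + 1)) * Ring.choose (α * (m + 1) - 1 / 2) m := by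
  have h : α * ((m : ℝ) + 1) + 1 / 2 = (α * (m + 1) - 1 / 2) + 1 := by ring
  have h0 : (α * ((m : ℝ) + 1) - 1 / 2) + 1 ≠ 0 := by
    have : 0 ≤ α * ((m : ℝ) + 1) := by positivity
    linarith
  rw [raneyNumber]
  push_cast
  rw [h, Ring.choose_add_one_succ]
  generalize α * ((m : ℝ) + 1) - 1 / 2 = y at *
  field_simp

/-- The moments in the coordinate `φ`. For `n ≥ 1` the primitive is
`(Im F(u) - σ ^ n Im u) / (π n)`, with `F` a primitive of `u ^ ((r + 1) n) / (u² - 1) ^ n = σ ^ n`;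
the term `σ ^ n Im u` vanishes at both ends. -/
lemma integral_raneyWeight_mul_pow (hr : 1 < r) (n : ℕ) :
    ∫ φ in Ioo 0 (Real.pi / ((r : ℝ) + 1)), raneyWeight r φ * raneySigma r φ ^ n =
      raneyNumber (((r : ℝ) + 1) / 2) (1 / 2) n := by
  cases n with
  | zero =>
    rw [raneyNumber_half_zero]
    simp only [pow_zero, mul_one]
    rw [(integrableOn_and_integral_eq_of_hasDerivAt_of_tendsto right_mem_Ioc.1
      (fun _ hφ => hasDerivAt_raneyCdfPrimitive hr hφ) (fun _ hφ => raneyWeight_nonneg hr hφ)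
      (tendsto_raneyCdfPrimitive_zero hr) (tendsto_raneyCdfPrimitive_right hr)).2]
    norm_num
  | succ m =>
    obtain ⟨F, hF, hF'⟩ := hasPrimitiveIncrement_pow_div_pow m ((r + 1) * (m + 1)) (by nlinarith)
    have ha := one_lt_sqrt_endpoint hr
    set a := Real.sqrt (((r : ℝ) + 1) / (r - 1))
    have hpi := Real.pi_pos
    have hm : (0 : ℝ) < m + 1 := by positivity
    have hc0 := tendsto_raneyCurve_zero hr
    have hcL := tendsto_raneyCurve_right hr
    have hderiv : ∀ φ ∈ Ioo 0 (Real.pi / ((r : ℝ) + 1)), HasDerivAt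
        (fun φ => ((F (raneyCurve r φ)).im - raneySigma r φ ^ (m + 1) * (raneyCurve r φ).im) /
          (Real.pi * (m + 1))) (raneyWeight r φ * raneySigma r φ ^ (m + 1)) φ := by
      intro φ hφ
      have hu := raneyCurve_mem_closedQuadrant hr hφ
      have hσ := raneySigma_pos hr hφ
      have hq := sq_sub_one_ne_zero_of_mem_closedQuadrant hu
      have hd := hasDerivAt_raneyCurve hr hφ
      have h := (((hF _ hu).scomp φ hd).complex_im.sub
        (((hasDerivAt_raneySigma hr hφ).1.fun_pow (m + 1)).fun_mul hd.complex_im)).div_const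
          (Real.pi * (m + 1))
      refine h.congr_deriv ?_
      have e : raneyCurve r φ ^ ((r + 1) * (m + 1)) / (raneyCurve r φ ^ 2 - 1) ^ (m + 1) =
          ((raneySigma r φ ^ (m + 1) : ℝ) : ℂ) := by
        rw [pow_mul, ← raneySigma_mul_sq_sub_one hr hφ, mul_pow,
          mul_div_cancel_right₀ _ (pow_ne_zero _ hq)]
        push_cast
        rfl
      simp only [e, smul_eq_mul, im_mul_ofReal, raneyWeight, Nat.add_sub_cancel]
      push_cast
      field_simp
      ring
    have h0 : Tendsto (fun φ => ((F (raneyCurve r φ)).im -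
        raneySigma r φ ^ (m + 1) * (raneyCurve r φ).im) / (Real.pi * (m + 1))) (𝓝[>] 0)
        (𝓝 (((F a).im - raneyEndpoint r ^ (m + 1) * (a : ℂ).im) / (Real.pi * (m + 1)))) :=
      ((((continuous_im.tendsto _).comp ((hF _
        (ofReal_mem_closedQuadrant ha)).continuousAt.tendsto.comp hc0))).sub
        (((tendsto_raneySigma_zero hr).pow (m + 1)).mul
          ((continuous_im.tendsto _).comp hc0))).div_const _
    have hL : Tendsto (fun φ => ((F (raneyCurve r φ)).im -
        raneySigma r φ ^ (m + 1) * (raneyCurve r φ).im) / (Real.pi * (m + 1)))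
        (𝓝[<] (Real.pi / ((r : ℝ) + 1)))
        (𝓝 (((F 0).im - 0 ^ (m + 1) * (0 : ℂ).im) / (Real.pi * (m + 1)))) :=
      ((((continuous_im.tendsto _).comp ((hF _
        zero_mem_closedQuadrant).continuousAt.tendsto.comp hcL))).sub
        (((tendsto_raneySigma_right hr).pow (m + 1)).mul
          ((continuous_im.tendsto _).comp hcL))).div_const _
    rw [(integrableOn_and_integral_eq_of_hasDerivAt_of_tendsto right_mem_Ioc.1 hderiv
      (fun φ hφ => mul_nonneg (raneyWeight_nonneg hr hφ) (pow_nonneg (raneySigma_pos hr hφ).le _))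
      h0 hL).2, raneyNumber_half_succ (by positivity), ofReal_im, zero_im, mul_zero, mul_zero,
      sub_zero, sub_zero, ← sub_div, hF' a ha]
    have e : (((((r + 1) * (m + 1) : ℕ) : ℝ)) - 1) / 2 = ((r : ℝ) + 1) / 2 * (m + 1) - 1 / 2 := by
      push_cast
      ring
    rw [e]
    field_simp

end Distribution

/-! ### The Raney distribution -/

section Measure

variable {r : ℕ}

variable (r) in
/-- The inverse of `σ` on `(0, x*)`; its values outside this interval are irrelevant. -/
noncomputable def raneyAngle : ℝ → ℝ :=
  Function.invFunOn (raneySigma r) (Ioo 0 (Real.pi / ((r : ℝ) + 1)))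

lemma raneyAngle_raneySigma (hr : 1 < r) {φ : ℝ} (hφ : φ ∈ Ioo 0 (Real.pi / ((r : ℝ) + 1))) :
    raneyAngle r (raneySigma r φ) = φ :=
  (bijOn_raneySigma hr).invOn_invFunOn.1 hφ

/-- The inverse of `σ` is monotone up to sign and maps an open interval onto an open interval,
which forces continuity. -/
lemma continuousOn_raneyAngle (hr : 1 < r) :
    ContinuousOn (raneyAngle r) (Ioo 0 (raneyEndpoint r)) := by
  have hb := bijOn_raneySigma hr
  have hmaps : ∀ φ ∈ Ioo 0 (Real.pi / ((r : ℝ) + 1)),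
    raneySigma r φ ∈ Ioo 0 (raneyEndpoint r) := fun φ hφ => hb.mapsTo hφ
  have hanti : MonotoneOn (fun x => -raneyAngle r x) (Ioo 0 (raneyEndpoint r)) := by
    intro x hx y hy hxy
    obtain ⟨φ, hφ, rfl⟩ := hb.surjOn hx
    obtain ⟨ψ, hψ, rfl⟩ := hb.surjOn hy
    simp only [raneyAngle_raneySigma hr hφ, raneyAngle_raneySigma hr hψ, neg_le_neg_iff]
    exact ((strictAntiOn_raneySigma hr).le_iff_ge hφ hψ).1 hxy
  intro x hx
  have h := continuousAt_of_monotoneOn_of_image_mem_nhds hanti (isOpen_Ioo.mem_nhds hx) (by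
    obtain ⟨φ, hφ, rfl⟩ := hb.surjOn hx
    simp only [raneyAngle_raneySigma hr hφ]
    refine mem_of_superset ((isOpen_Ioo (a := -(Real.pi / ((r : ℝ) + 1))) (b := 0)).mem_nhds
      ⟨neg_lt_neg hφ.2, neg_lt_zero.2 hφ.1⟩) fun t ht => ?_
    have ht' : -t ∈ Ioo 0 (Real.pi / ((r : ℝ) + 1)) := ⟨by linarith [ht.2], by linarith [ht.1]⟩
    exact ⟨raneySigma r (-t), hmaps _ ht', by simp [raneyAngle_raneySigma hr ht']⟩)
  simpa only [Pi.neg_def, neg_neg] using! h.neg.continuousWithinAt (s := Ioo 0 (raneyEndpoint r))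

variable (r) in
/-- The density `v(x) = Im u / (π x)`, where `u` is the point of the curve with `σ = x`. -/
noncomputable def raneyDensity (x : ℝ) : ℝ :=
  (raneyCurve r (raneyAngle r x)).im / (Real.pi * x)

lemma raneyDensity_raneySigma (hr : 1 < r) {φ : ℝ}
    (hφ : φ ∈ Ioo 0 (Real.pi / ((r : ℝ) + 1))) :
    raneyDensity r (raneySigma r φ) = (raneyCurve r φ).im / (Real.pi * raneySigma r φ) := by
  rw [raneyDensity, raneyAngle_raneySigma hr hφ]

lemma abs_deriv_raneySigma_mul_raneyDensity (hr : 1 < r) {φ : ℝ}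
    (hφ : φ ∈ Ioo 0 (Real.pi / ((r : ℝ) + 1))) :
    |deriv (raneySigma r) φ| * raneyDensity r (raneySigma r φ) = raneyWeight r φ := by
  rw [raneyDensity_raneySigma hr hφ, abs_of_neg (hasDerivAt_raneySigma hr hφ).2, raneyWeight,
    mul_div_assoc]

lemma raneyDensity_nonneg (hr : 1 < r) {x : ℝ} (hx : x ∈ Ioo 0 (raneyEndpoint r)) :
    0 ≤ raneyDensity r x := by
  obtain ⟨φ, hφ, rfl⟩ := (bijOn_raneySigma hr).surjOn hx
  rw [raneyDensity_raneySigma hr hφ]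
  exact div_nonneg (raneyCurve_im_pos hr hφ).le
    (mul_nonneg Real.pi_pos.le (raneySigma_pos hr hφ).le)

lemma continuousOn_raneyDensity (hr : 1 < r) :
    ContinuousOn (raneyDensity r) (Ioo 0 (raneyEndpoint r)) := by
  have hc : ContinuousOn (raneyCurve r) (Ioo 0 (Real.pi / ((r : ℝ) + 1))) :=
    fun φ hφ => (hasDerivAt_raneyCurve hr hφ).continuousAt.continuousWithinAt
  have hmaps : MapsTo (raneyAngle r) (Ioo 0 (raneyEndpoint r))
      (Ioo 0 (Real.pi / ((r : ℝ) + 1))) := by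
    intro x hx
    obtain ⟨φ, hφ, rfl⟩ := (bijOn_raneySigma hr).surjOn hx
    rwa [raneyAngle_raneySigma hr hφ]
  exact (continuous_im.comp_continuousOn (hc.comp (continuousOn_raneyAngle hr) hmaps)).div
    (by fun_prop) fun x hx => mul_ne_zero Real.pi_ne_zero hx.1.ne'

variable (r) in
/-- The measure on `(0, x*)` with density `raneyDensity`. -/
noncomputable def raneyMeasure : Measure ℝ :=
  (volume.restrict (Ioo 0 (raneyEndpoint r))).withDensity
    (fun x => ENNReal.ofReal (raneyDensity r x))

lemma isContinuousDensityOn_raneyDensity (hr : 1 < r) :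
    IsContinuousDensityOn (raneyDensity r) (Ioo 0 (raneyEndpoint r)) (raneyMeasure r) :=
  ⟨continuousOn_raneyDensity hr, fun _ hx => raneyDensity_nonneg hr hx, rfl⟩

lemma integral_raneyMeasure (hr : 1 < r) (f : ℝ → ℝ) :
    ∫ x, f x ∂(raneyMeasure r) =
      ∫ φ in Ioo 0 (Real.pi / ((r : ℝ) + 1)), raneyWeight r φ * f (raneySigma r φ) := by
  have hm : AEMeasurable (fun x => ENNReal.ofReal (raneyDensity r x))
      (volume.restrict (Ioo 0 (raneyEndpoint r))) :=
    ((continuousOn_raneyDensity hr).aemeasurable measurableSet_Ioo).ennreal_ofReal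
  rw [raneyMeasure, integral_withDensity_eq_integral_toReal_smul₀ hm (by simp),
    ← (bijOn_raneySigma hr).image_eq, integral_image_eq_integral_abs_deriv_smul measurableSet_Ioo
      (fun φ hφ => (hasDerivAt_raneySigma hr hφ).1.hasDerivWithinAt) (bijOn_raneySigma hr).injOn]
  refine setIntegral_congr_fun measurableSet_Ioo fun φ hφ => ?_
  simp only [smul_eq_mul]
  rw [ENNReal.toReal_ofReal (raneyDensity_nonneg hr ((bijOn_raneySigma hr).mapsTo hφ)),
    ← mul_assoc, abs_deriv_raneySigma_mul_raneyDensity hr hφ]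

lemma isProbabilityMeasure_raneyMeasure (hr : 1 < r) :
    IsProbabilityMeasure (raneyMeasure r) := by
  have h := (integral_raneyMeasure hr fun _ => 1).trans
    ((by simp : _ = ∫ φ in Ioo 0 (Real.pi / ((r : ℝ) + 1)),
      raneyWeight r φ * raneySigma r φ ^ 0).trans (integral_raneyWeight_mul_pow hr 0))
  rw [raneyNumber_half_zero, integral_const, smul_eq_mul, mul_one, measureReal_def,
    ENNReal.toReal_eq_one_iff] at h
  exact ⟨h⟩

lemma isRaneyDistribution_raneyMeasure (hr : 1 < r) :
    IsRaneyDistribution (((r : ℝ) + 1) / 2) (1 / 2) (raneyMeasure r) := by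
  refine ⟨isProbabilityMeasure_raneyMeasure hr, ⟨raneyEndpoint r, ?_⟩, fun n => ?_⟩
  · refine withDensity_absolutelyContinuous _ _ ?_
    rw [Measure.restrict_apply measurableSet_Icc.compl]
    convert! measure_empty (μ := (volume : Measure ℝ))
    rw [← disjoint_iff_inter_eq_empty, disjoint_compl_left_iff]
    exact Ioo_subset_Icc_self
  · rw [integral_raneyMeasure hr, integral_raneyWeight_mul_pow hr]

lemma IsRaneyDistribution.unique {α β : ℝ} {μ ν : Measure ℝ} (hμ : IsRaneyDistribution α β μ)
    (hν : IsRaneyDistribution α β ν) : μ = ν := by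
  obtain ⟨b, hb⟩ := hμ.exists_support_subset
  obtain ⟨c, hc⟩ := hν.exists_support_subset
  have := hμ.isProbabilityMeasure
  have := hν.isProbabilityMeasure
  refine Measure.eq_of_integral_pow_eq (b := max b c)
    (measure_mono_null (compl_subset_compl.2 (Icc_subset_Icc_right (le_max_left _ _))) hb)
    (measure_mono_null (compl_subset_compl.2 (Icc_subset_Icc_right (le_max_right _ _))) hc)
    fun n => ?_
  rw [hμ.moment_eq, hν.moment_eq]

lemma IsContinuousDensityOn.eqOn {v w : ℝ → ℝ} {s : Set ℝ} {μ : Measure ℝ} [IsFiniteMeasure μ]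
    (hs : IsOpen s) (hv : IsContinuousDensityOn v s μ) (hw : IsContinuousDensityOn w s μ) :
    EqOn v w s := by
  have hv' := hv.continuousOn.aemeasurable (μ := volume) hs.measurableSet
  have hw' := hw.continuousOn.aemeasurable (μ := volume) hs.measurableSet
  have h := (withDensity_eq_iff_of_sigmaFinite hv'.ennreal_ofReal hw'.ennreal_ofReal).1
    (hv.eq_withDensity.symm.trans hw.eq_withDensity)
  refine Measure.eqOn_open_of_ae_eq (μ := volume) ?_ hs hv.continuousOn hw.continuousOn
  filter_upwards [h, ae_restrict_mem hs.measurableSet] with x hx hxs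
  exact (ENNReal.ofReal_eq_ofReal_iff (hv.nonneg x hxs) (hw.nonneg x hxs)).1 hx

lemma raneyDensity_raneySigma_eq (hr : 1 < r) {φ : ℝ}
    (hφ : φ ∈ Ioo 0 (Real.pi / ((r : ℝ) + 1))) :
    raneyDensity r (raneySigma r φ) =
      Real.sin (2 * φ) * Real.sin φ * Real.sin (((r : ℝ) - 1) * φ) ^ ((r : ℝ) / 2 - 1) /
        (Real.pi * Real.sin (((r : ℝ) + 1) * φ) ^ ((r : ℝ) / 2)) := by
  have h1 := sin_add_one_mul_pos hr hφ
  have h2 := sin_sub_one_mul_pos hr (Ioo_subset_Ioc_self hφ)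
  have h3 := sin_two_mul_pos hr (Ioo_subset_Ioc_self hφ)
  have h4 := raneyRadius_pos hr hφ
  have e : ∀ x : ℝ, 0 < x → x ^ ((r : ℝ) / 2) = Real.sqrt x ^ r := by
    intro x hx
    rw [Real.sqrt_eq_rpow, ← Real.rpow_natCast, ← Real.rpow_mul hx.le]
    congr 1
    ring
  rw [raneyDensity_raneySigma hr hφ, raneySigma_eq_raneyRadius_pow hr hφ, raneyCurve_im,
    Real.rpow_sub_one h2.ne', e _ h1, e _ h2]
  have h5 : raneyRadius r φ ^ r = Real.sqrt (Real.sin (((r : ℝ) + 1) * φ)) ^ r /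
      Real.sqrt (Real.sin (((r : ℝ) - 1) * φ)) ^ r := by
    rw [raneyRadius, Real.sqrt_div h1.le, div_pow]
  have h6 := pow_pos (Real.sqrt_pos.2 h1) r
  have h7 := pow_pos (Real.sqrt_pos.2 h2) r
  have hpi := Real.pi_pos
  rw [pow_succ, h5]
  generalize Real.sqrt (Real.sin (((r : ℝ) + 1) * φ)) ^ r = A at *
  generalize Real.sqrt (Real.sin (((r : ℝ) - 1) * φ)) ^ r = B at *
  generalize Real.sin (((r : ℝ) - 1) * φ) = S at *
  generalize Real.sin (2 * φ) = s at *
  field_simp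

lemma image_raneySigma_Ioo (hr : 1 < r) {φ : ℝ} (hφ : φ ∈ Ioo 0 (Real.pi / ((r : ℝ) + 1))) :
    raneySigma r '' Ioo φ (Real.pi / ((r : ℝ) + 1)) = Ioo 0 (raneySigma r φ) := by
  have hsub := Ioo_subset_Ioo_left (b := Real.pi / ((r : ℝ) + 1)) hφ.1.le
  exact (bijOn_Ioo_of_strictAntiOn hφ.2 ((strictAntiOn_raneySigma hr).mono hsub)
    ((continuousOn_raneySigma hr).mono hsub)
    ((hasDerivAt_raneySigma hr hφ).1.continuousAt.tendsto.mono_left nhdsWithin_le_nhds)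
    (tendsto_raneySigma_right hr)).image_eq

lemma cdf_raneyMeasure (hr : 1 < r) {φ : ℝ} (hφ : φ ∈ Ioo 0 (Real.pi / ((r : ℝ) + 1))) :
    ProbabilityTheory.cdf (raneyMeasure r) (raneySigma r φ) = 1 / 2 - raneyCdfPrimitive r φ := by
  have := isProbabilityMeasure_raneyMeasure hr
  have hsub := Ioo_subset_Ioo_left (b := Real.pi / ((r : ℝ) + 1)) hφ.1.le
  have hx := (bijOn_raneySigma hr).mapsTo hφ
  obtain ⟨hint, hval⟩ := integrableOn_raneyWeight_Ioo_and_integral hr hφ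
  have hset : Iic (raneySigma r φ) ∩ Ioo 0 (raneyEndpoint r) = Ioc 0 (raneySigma r φ) := by
    ext x
    constructor
    · exact fun h => ⟨h.2.1, h.1⟩
    · exact fun h => ⟨h.2, h.1, h.2.trans_lt hx.2⟩
  have hμ : raneyMeasure r (Iic (raneySigma r φ)) =
      ENNReal.ofReal (1 / 2 - raneyCdfPrimitive r φ) := by
    rw [raneyMeasure, withDensity_apply _ measurableSet_Iic,
      Measure.restrict_restrict measurableSet_Iic, hset, restrict_Ioo_eq_restrict_Ioc.symm,
      ← image_raneySigma_Ioo hr hφ, lintegral_image_eq_lintegral_abs_deriv_mul measurableSet_Ioo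
        (fun ψ hψ => (hasDerivAt_raneySigma hr (hsub hψ)).1.hasDerivWithinAt)
        ((bijOn_raneySigma hr).injOn.mono hsub), ← hval,
      ofReal_integral_eq_lintegral_ofReal hint]
    · refine setLIntegral_congr_fun measurableSet_Ioo fun ψ hψ => ?_
      rw [← ENNReal.ofReal_mul (abs_nonneg _),
        abs_deriv_raneySigma_mul_raneyDensity hr (hsub hψ)]
    · filter_upwards [ae_restrict_mem measurableSet_Ioo] with ψ hψ
      exact raneyWeight_nonneg hr (hsub hψ)
  rw [ProbabilityTheory.cdf_eq_real, measureReal_def, hμ, ENNReal.toReal_ofReal]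
  rw [← hval]
  exact setIntegral_nonneg measurableSet_Ioo fun ψ hψ => raneyWeight_nonneg hr (hsub hψ)

end Measure

theorem theorem3p2 (r : ℕ) (hr : 1 < r) :
    -- the coordinate change `x = σ(φ)` is a strictly decreasing bijection
    StrictAntiOn (raneySigma r) (Set.Ioo 0 (Real.pi / ((r : ℝ) + 1))) ∧
    Set.BijOn (raneySigma r) (Set.Ioo 0 (Real.pi / ((r : ℝ) + 1)))
      (Set.Ioo 0 (raneyEndpoint r)) ∧
    -- the Raney distribution exists and is unique
    (∃! μ : Measure ℝ, IsRaneyDistribution (((r : ℝ) + 1) / 2) (1 / 2) μ) ∧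
    ∀ μ : Measure ℝ, IsRaneyDistribution (((r : ℝ) + 1) / 2) (1 / 2) μ →
      -- it has a continuous density on `(0, x*)`
      (∃ v : ℝ → ℝ, IsContinuousDensityOn v (Set.Ioo 0 (raneyEndpoint r)) μ) ∧
      -- the density in the coordinate `φ`
      (∀ v : ℝ → ℝ, IsContinuousDensityOn v (Set.Ioo 0 (raneyEndpoint r)) μ →
        ∀ φ ∈ Set.Ioo 0 (Real.pi / ((r : ℝ) + 1)),
          v (raneySigma r φ) =
            Real.sin (2 * φ) * Real.sin φ * Real.sin (((r : ℝ) - 1) * φ) ^ ((r : ℝ) / 2 - 1) /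
              (Real.pi * Real.sin (((r : ℝ) + 1) * φ) ^ ((r : ℝ) / 2))) ∧
      -- the distribution function in the coordinate `φ`
      ∀ φ ∈ Set.Ioo 0 (Real.pi / ((r : ℝ) + 1)),
        ProbabilityTheory.cdf μ (raneySigma r φ) =
          1 / 2 + ((r : ℝ) - 1) * Real.sin φ / Real.pi *
              (Real.sin (((r : ℝ) + 1) * φ) / Real.sin (((r : ℝ) - 1) * φ)) ^ (1 / 2 : ℝ) +
            1 / Real.pi * Real.arctan (Real.cos ((r : ℝ) * φ) /
              Real.sqrt (Real.sin (((r : ℝ) - 1) * φ) * Real.sin (((r : ℝ) + 1) * φ))) := by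
  have hR := isRaneyDistribution_raneyMeasure hr
  have hprob := isProbabilityMeasure_raneyMeasure hr
  refine ⟨strictAntiOn_raneySigma hr, bijOn_raneySigma hr, ⟨raneyMeasure r, hR,
    fun μ hμ => hμ.unique hR⟩, fun μ hμ => ?_⟩
  obtain rfl := hμ.unique hR
  refine ⟨⟨_, isContinuousDensityOn_raneyDensity hr⟩, fun v hv φ hφ => ?_, fun φ hφ => ?_⟩
  · rw [← raneyDensity_raneySigma_eq hr hφ]
    exact hv.eqOn isOpen_Ioo (isContinuousDensityOn_raneyDensity hr)
      ((bijOn_raneySigma hr).mapsTo hφ)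
  · rw [cdf_raneyMeasure hr hφ, raneyCdfPrimitive_eq hr hφ, ← Real.sqrt_eq_rpow, ← raneyRadius]
    ring
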